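/- Consider finite labeled Markov decision processes (MDPs): a finite state set $V$, a finite action alphabet $\Gamma$, for each state $v$ a nonempty set $\Gamma_v\subseteq\Gamma$ of enabled actions, for each $\gamma\in\Gamma_v$ a rational probability distribution on the next state, and a labeling of the states by subsets of a finite set of predicates. The transitions are the triples $(v,\gamma,v')$ with $\gamma\in\Gamma_v$ of positive probability. The size of an MDP is its number of states plus its total number of state labels plus its number of transitions plus the total number of bits of the numerators and denominators (in binary) of the probabilities of all transitions. A strategy $\sigma$ maps every finite history in $(V\Gamma)^*V$ to a probability distribution on the actions enabled at its last state, and $\Pr^\sigma_u(\Diamond P)$ denotes the probability that the run from the initial state $u$ under $\sigma$ visits a state labeled $P$. For two predicates $P_1,P_2$ let $$U_u=\{r\in\mathbb R_{\ge 0}^2 : \exists\,\sigma,\ r_i\le \Pr\nolimits^\sigma_u(\Diamond P_i)\text{ for } i=1,2\}$$ be the set of achievable vectors. Its Pareto curve $\mathcal P_u$ is the set of all $v\in U_u$ for which there is no $v'\in U_u$ with $v\le v'$ coordinatewise and $v'\ne v$. The vertices of the Pareto curve are the extreme points of $U_u$ that lie in $\mathcal P_u$, and its facets are the one-dimensional exposed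 faces (edges) of $U_u$ that are contained in $\mathcal P_u$. Theorem. There is a family $\langle M(n)\mid n\in\mathbb N\rangle$ of MDPs labeled by two predicates $P_1,P_2$, where $M(n)$ has $n$ states and size $O(n)$, such that for suitable initial states the Pareto curve of $M(n)$ for the two reachability objectives $\Diamond P_1,\Diamond P_2$ has $n^{\Omega(\log n)}$ vertices and $n^{\Omega(\log n)}$ facets. That is, there are constants $C$, $c>0$ and $n_0$ such that $M(n)$ has size at most $Cn$ for all $n$, and for every $n\ge n_0$ there is a state $u$ of $M(n)$ such that the set of vertices and the set of facets of the Pareto curve of $M(n)$ with initial state $u$ are finite and each have at least $n^{c\log n}$ elements. -/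

import Mathlib

open MeasureTheory ProbabilityTheory

namespace MultiObjective

/-- A finite labeled Markov decision process with state set `V`, action alphabet `Γ` and set of
propositional predicates `Q`. A pair `(v, γ)` with `γ ∈ enabled v` determines the rational
probability distribution `prob v γ` of the next state; the transitions of the MDP are the triples
`(v, γ, v')` with `prob v γ v' ≠ 0`. -/
structure LabeledMDP (V Γ Q : Type) [Fintype V] where
  enabled : V → Finset Γ
  enabled_nonempty : ∀ v, (enabled v).Nonempty
  prob : V → Γ → V → ℚ
  prob_nonneg : ∀ v γ v', 0 ≤ prob v γ v'
  prob_sum : ∀ v, ∀ γ ∈ enabled v, ∑ v', prob v γ v' = 1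
  prob_disabled : ∀ v γ v', γ ∉ enabled v → prob v γ v' = 0
  label : V → Finset Q

/-- A finite history of play, an element `w v` of `(V Γ)* V`: `past` is the word `w` (oldest letter
first) and `last` is the current state `v`. -/
structure History (V Γ : Type) where
  past : List (V × Γ)
  last : V

namespace History

variable {V Γ : Type}

/-- The history that consists of the state `u` only. -/
def start (u : V) : History V Γ := ⟨[], u⟩

/-- The history `w v γ v'` that extends the history `w v`. -/
def extend (h : History V Γ) (γ : Γ) (v' : V) : History V Γ := ⟨h.past ++ [(h.last, γ)], v'⟩

/-- Histories form a discrete measurable space. -/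
instance : MeasurableSpace (History V Γ) := ⊤

end History

/-- The word properties over the alphabet `2^Q` (sets of infinite words). -/
abbrev WordProperty (Q : Type) : Type := Set (ℕ → Finset Q)

/-- The reachability property `◇ P`. -/
def eventually {Q : Type} (P : Q) : WordProperty Q := {w | ∃ i, P ∈ w i}

/-- The number of bits of numerator and denominator of a rational number, both in binary. -/
def ratBits (q : ℚ) : ℕ := q.num.natAbs.size + q.den.size

namespace LabeledMDP

variable {V Γ Q : Type} [Fintype V] [Fintype Γ]

/-- The encoding size of a labeled MDP: one unit for each state, each label of a state, and each
transition, plus the number of bits of the (binary) numerators and denominators of the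
probabilities of all transitions. -/
def size (M : LabeledMDP V Γ Q) : ℕ :=
  (∑ v, (1 + (M.label v).card)) +
    ∑ v, ∑ γ, ∑ v', if M.prob v γ v' = 0 then 0 else 1 + ratBits (M.prob v γ v')

/-- A (history dependent, randomized) strategy: it maps every history to a probability
distribution on the actions enabled at the last state of the history. -/
structure Strategy (M : LabeledMDP V Γ Q) where
  dist : History V Γ → PMF Γ
  support_subset : ∀ h, (dist h).support ⊆ M.enabled h.last

/-- One step of the Markov chain of histories induced by `σ`: from the history `h = w v` it moves
to `w v γ v'` with probability `σ(w v)(γ) · prob v γ v'`. -/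
noncomputable def stepMeasure (M : LabeledMDP V Γ Q) (σ : M.Strategy) (h : History V Γ) :
    Measure (History V Γ) :=
  ∑ γ, ∑ v', (σ.dist h γ * ENNReal.ofReal (M.prob h.last γ v' : ℝ)) •
    Measure.dirac (h.extend γ v')

instance (M : LabeledMDP V Γ Q) (σ : M.Strategy) (h : History V Γ) :
    IsProbabilityMeasure (M.stepMeasure σ h) := by
  constructor
  have key : ∀ γ, ∑ v', σ.dist h γ * ENNReal.ofReal (M.prob h.last γ v' : ℝ) = σ.dist h γ := by
    intro γ
    by_cases hγ : γ ∈ M.enabled h.last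
    · rw [← Finset.mul_sum, ← ENNReal.ofReal_sum_of_nonneg
        (fun v' _ => by exact_mod_cast M.prob_nonneg h.last γ v')]
      have := M.prob_sum h.last γ hγ
      have h2 : ∑ v', (M.prob h.last γ v' : ℝ) = 1 := by exact_mod_cast this
      rw [h2, ENNReal.ofReal_one, mul_one]
    · have h0 : σ.dist h γ = 0 := by
        by_contra hne
        exact hγ (σ.support_subset h ((PMF.mem_support_iff _ _).2 hne))
      simp [h0]
  have h1 : ∑ γ, σ.dist h γ = 1 := by
    rw [← tsum_fintype (L := .unconditional _)]
    exact (σ.dist h).tsum_coe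
  simp [stepMeasure, key, h1]

/-- The transition kernel of the Markov chain of histories induced by `σ`. -/
noncomputable def stepKernel (M : LabeledMDP V Γ Q) (σ : M.Strategy) :
    Kernel (History V Γ) (History V Γ) :=
  ⟨M.stepMeasure σ, measurable_from_top⟩

instance (M : LabeledMDP V Γ Q) (σ : M.Strategy) : IsMarkovKernel (M.stepKernel σ) :=
  ⟨fun h => inferInstanceAs (IsProbabilityMeasure (M.stepMeasure σ h))⟩

/-- The step kernel, seen as a function of the whole initial piece `θ 0, …, θ n` of a run of the
Markov chain; it depends on `θ n` only. -/
noncomputable def runKernel (M : LabeledMDP V Γ Q) (σ : M.Strategy) (n : ℕ) :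
    Kernel ((i : Finset.Iic n) → (fun _ : ℕ => History V Γ) i) (History V Γ) :=
  (M.stepKernel σ).comap (fun θ => θ ⟨n, Finset.mem_Iic.2 le_rfl⟩) (measurable_pi_apply _)

instance (M : LabeledMDP V Γ Q) (σ : M.Strategy) (n : ℕ) : IsMarkovKernel (M.runKernel σ n) :=
  inferInstanceAs (IsMarkovKernel ((M.stepKernel σ).comap _ _))

/-- The law of the run `θ 0, θ 1, …` of the Markov chain of histories that is induced by the
strategy `σ` and starts in the state `u`. -/
noncomputable def runMeasure (M : LabeledMDP V Γ Q) (σ : M.Strategy) (u : V) :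
    Measure (ℕ → History V Γ) :=
  Kernel.traj (X := fun _ => History V Γ) (M.runKernel σ) 0 (fun _ => History.start u)

/-- The probability that the word of labels along a run, under the strategy `σ` and from the
initial state `u`, lies in `φ`. -/
noncomputable def pr (M : LabeledMDP V Γ Q) (σ : M.Strategy) (u : V) (φ : WordProperty Q) : ℝ :=
  (M.runMeasure σ u).real {θ | (fun i => M.label (θ i).last) ∈ φ}

/-- The set of achievable value vectors for the tuple `Φ` of properties. -/
def achievable (M : LabeledMDP V Γ Q) (u : V) {k : ℕ} (Φ : Fin k → WordProperty Q) :
    Set (Fin k → ℝ) :=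
  {r | (∀ i, 0 ≤ r i) ∧ ∃ σ : M.Strategy, ∀ i, r i ≤ M.pr σ u (Φ i)}

end LabeledMDP

/-- The Pareto curve of a set `U` of vectors: the vectors of `U` that no other vector of `U`
dominates. -/
def paretoCurve {k : ℕ} (U : Set (Fin k → ℝ)) : Set (Fin k → ℝ) :=
  {v | v ∈ U ∧ ¬ ∃ v' ∈ U, v ≤ v' ∧ v ≠ v'}

/-- The vertices of the Pareto curve of a polytope `U`: the vertices (extreme points) of `U` that
are Pareto optimal. -/
def paretoVertices {k : ℕ} (U : Set (Fin k → ℝ)) : Set (Fin k → ℝ) :=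
  paretoCurve U ∩ U.extremePoints ℝ

/-- The facets of the Pareto curve of a polytope `U` in `ℝ^k`: the faces of `U` of dimension
`k - 1` all of whose points are Pareto optimal. -/
def paretoFacets {k : ℕ} (U : Set (Fin k → ℝ)) : Set (Set (Fin k → ℝ)) :=
  {F | F.Nonempty ∧ IsExposed ℝ U F ∧ Module.finrank ℝ (vectorSpan ℝ F) + 1 = k ∧
    F ⊆ paretoCurve U}

end MultiObjective

/-! ### Laws of runs and finite-horizon expectations -/

open MeasureTheory ProbabilityTheory

namespace MultiObjective

namespace LabeledMDP

variable {V Γ Q : Type} [Fintype V] [Fintype Γ]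

/-! The proof constructs MDPs whose optimal weighted value is built from iterates of the tent map
`tent`, and so has exponentially many kinks as the weights vary.

Parametrize the positive weight directions by `(1 - y, 1 + y)` with `-1 < y < 1`. Each level of
`tentMDP` has three states: an averaging state `a`, a choice state `b` and a scaling state `c`. One
level up, `a` averages `a`, `b`, `c` with weights 2/5, 2/5, 1/5; `b` moves with probability 4/5 to
the better of `a`, `b`; `c` keeps 1/5 of its value. The sink takes the remaining mass. Since `2 *
max a b = a + b + |a - b|`, the difference `a - b`, measured in units of `c`, undergoes one step `x
↦ 1 - 2|x|`. It starts as `y`, so at level `k` it is `tent^[k] y` (`tentValue_level`), which has `2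
^ k` zeros in `(-1, 1)` (`card_tentZeros`).

At each zero both actions of the next choice state are optimal. If the maximizing face were a single
point, the optima of `a` and `b` would be one and the same point, and the two values would agree on
a neighbourhood of `y`, against the finiteness of the zeros (`tiltFace_nontrivial`). So every zero
yields an edge with its own normal direction. Edges with distinct normals are distinct, and the pair
of endpoints of an edge determines its normal, so there are at least `2 ^ k` facets and at least the
square root of `2 ^ k` vertices. As `k` is about `n / 3`, this exponential bound exceeds the
required one.

The link to strategies is `achievable_eventually_eq`: all runs are absorbed within `n` steps, so the
achievable set is the nonnegative part of the downward closure of the convex hull of finitely many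
deterministic values. -/

instance : DiscreteMeasurableSpace (History V Γ) := ⟨fun _ => trivial⟩

instance : Countable (History V Γ) :=
  Function.Injective.countable (f := fun h : History V Γ => (h.past, h.last))
    (fun ⟨_, _⟩ ⟨_, _⟩ h => by simpa using h)

lemma lintegral_stepMeasure (M : LabeledMDP V Γ Q) (σ : M.Strategy) (h : History V Γ)
    (f : History V Γ → ENNReal) :
    ∫⁻ h', f h' ∂M.stepMeasure σ h =
      ∑ γ, ∑ v', (σ.dist h γ * ENNReal.ofReal (M.prob h.last γ v' : ℝ)) * f (h.extend γ v') := by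
  simp [stepMeasure, lintegral_finsetSum_measure, lintegral_dirac]

instance (M : LabeledMDP V Γ Q) (σ : M.Strategy) (u : V) :
    IsProbabilityMeasure (M.runMeasure σ u) := by
  unfold runMeasure
  infer_instance

/-- The Markov property, in the only form needed: given the initial segment up to time `n`, the next
history is drawn from the step measure at its last entry. -/
lemma lintegral_runMeasure_pair (M : LabeledMDP V Γ Q) (σ : M.Strategy) (u : V) (n : ℕ)
    (f : History V Γ × History V Γ → ENNReal) :
    ∫⁻ θ, f (θ n, θ (n + 1)) ∂M.runMeasure σ u =
      ∫⁻ θ, ∫⁻ h', f (θ n, h') ∂M.stepMeasure σ (θ n) ∂M.runMeasure σ u := by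
  have hf : Measurable f := .of_discrete
  have key := Kernel.partialTraj_compProd_eq_map_traj (X := fun _ => History V Γ)
    (κ := M.runKernel σ) (Nat.zero_le n) (x₀ := fun _ => History.start u)
  set g : ((i : Finset.Iic n) → (fun _ : ℕ => History V Γ) i) × History V Γ → ENNReal :=
    fun x => f (x.1 ⟨n, Finset.mem_Iic.2 le_rfl⟩, x.2) with hg
  have hgm : Measurable g := by fun_prop
  have h1 : ∫⁻ θ, f (θ n, θ (n + 1)) ∂M.runMeasure σ u =
      ∫⁻ x, g x ∂((M.runMeasure σ u).map
        (fun x => (Preorder.frestrictLe (π := fun _ => History V Γ) n x, x (n + 1)))) := by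
    rw [lintegral_map hgm (by fun_prop)]
    rfl
  have h2 : (M.runMeasure σ u).map
      (Preorder.frestrictLe (π := fun _ => History V Γ) n) =
      Kernel.partialTraj (X := fun _ => History V Γ) (M.runKernel σ) 0 n
        (fun _ => History.start u) :=
    Kernel.traj_map_frestrictLe_apply 0 n _
  rw [h1]
  erw [← key]
  rw [Measure.lintegral_compProd hgm, ← h2, lintegral_map _ (by fun_prop)]
  · rfl
  · exact hgm.lintegral_kernel_prod_right'

lemma lintegral_runMeasure_zero (M : LabeledMDP V Γ Q) (σ : M.Strategy) (u : V)
    (f : History V Γ → ENNReal) :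
    ∫⁻ θ, f (θ 0) ∂M.runMeasure σ u = f (History.start u) := by
  have hf : Measurable f := measurable_from_top
  have h2 : (M.runMeasure σ u).map
      (Preorder.frestrictLe (π := fun _ => History V Γ) 0) =
      Kernel.partialTraj (X := fun _ => History V Γ) (M.runKernel σ) 0 0
        (fun _ => History.start u) :=
    Kernel.traj_map_frestrictLe_apply 0 0 _
  rw [Kernel.partialTraj_self, Kernel.id_apply] at h2
  set g : ((i : Finset.Iic 0) → (fun _ : ℕ => History V Γ) i) → ENNReal :=
    fun x => f (x ⟨0, Finset.mem_Iic.2 le_rfl⟩) with hg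
  have hgm : Measurable g := by fun_prop
  have h1 : ∫⁻ θ, f (θ 0) ∂M.runMeasure σ u =
      ∫⁻ x, g x ∂((M.runMeasure σ u).map
        (Preorder.frestrictLe (π := fun _ => History V Γ) 0)) := by
    rw [lintegral_map hgm (by fun_prop)]
    rfl
  rw [h1, h2, lintegral_dirac' _ hgm]

/-- The expected value, under the strategy `σ` and from the history `h` on, of the function `g` of
the state that is reached after `m` steps. -/
noncomputable def expect {E : Type*} [AddCommGroup E] [Module ℝ E] (M : LabeledMDP V Γ Q)
    (σ : M.Strategy) (g : V → E) : ℕ → History V Γ → E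
  | 0, h => g h.last
  | m + 1, h => ∑ γ, ∑ v', ((σ.dist h γ).toReal * (M.prob h.last γ v' : ℝ)) •
      expect M σ g m (h.extend γ v')

lemma expect_apply {ι : Type*} (M : LabeledMDP V Γ Q) (σ : M.Strategy) (g : V → ι → ℝ) (m : ℕ)
    (h : History V Γ) (i : ι) : M.expect σ g m h i = M.expect σ (fun v => g v i) m h := by
  induction m generalizing h with
  | zero => rfl
  | succ m ih => simp [expect, ih]

lemma expect_nonneg (M : LabeledMDP V Γ Q) (σ : M.Strategy) {g : V → ℝ} (hg : ∀ v, 0 ≤ g v)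
    (m : ℕ) (h : History V Γ) : 0 ≤ M.expect σ g m h := by
  induction m generalizing h with
  | zero => exact hg _
  | succ m ih =>
    refine Finset.sum_nonneg fun γ _ => Finset.sum_nonneg fun v' _ => ?_
    have : (0 : ℝ) ≤ M.prob h.last γ v' := by exact_mod_cast M.prob_nonneg _ _ _
    exact mul_nonneg (mul_nonneg ENNReal.toReal_nonneg this) (ih _)

lemma lintegral_ofReal_expect (M : LabeledMDP V Γ Q) (σ : M.Strategy) {g : V → ℝ}
    (hg : ∀ v, 0 ≤ g v) (m : ℕ) (h : History V Γ) :
    ∫⁻ h', ENNReal.ofReal (M.expect σ g m h') ∂M.stepMeasure σ h =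
      ENNReal.ofReal (M.expect σ g (m + 1) h) := by
  have hp : ∀ γ v', (0 : ℝ) ≤ M.prob h.last γ v' := fun γ v' => by
    exact_mod_cast M.prob_nonneg _ _ _
  have hn : ∀ γ v', 0 ≤ ((σ.dist h γ).toReal * (M.prob h.last γ v' : ℝ)) •
      M.expect σ g m (h.extend γ v') := fun γ v' =>
    mul_nonneg (mul_nonneg ENNReal.toReal_nonneg (hp γ v')) (M.expect_nonneg σ hg _ _)
  rw [lintegral_stepMeasure, expect,
    ENNReal.ofReal_sum_of_nonneg fun γ _ => Finset.sum_nonneg fun v' _ => hn γ v']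
  refine Finset.sum_congr rfl fun γ _ => ?_
  rw [ENNReal.ofReal_sum_of_nonneg fun v' _ => hn γ v']
  refine Finset.sum_congr rfl fun v' _ => ?_
  rw [smul_eq_mul, ENNReal.ofReal_mul (mul_nonneg ENNReal.toReal_nonneg (hp γ v')),
    ENNReal.ofReal_mul ENNReal.toReal_nonneg, ENNReal.ofReal_toReal ((σ.dist h).apply_ne_top γ)]

/-- The expected continuation value is conserved along the run, by the Markov property; `m = 0`
turns it into a statement about the law at time `n`. -/
lemma lintegral_runMeasure_expect (M : LabeledMDP V Γ Q) (σ : M.Strategy) (u : V) {g : V → ℝ}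
    (hg : ∀ v, 0 ≤ g v) (n m : ℕ) :
    ∫⁻ θ, ENNReal.ofReal (M.expect σ g m (θ n)) ∂M.runMeasure σ u =
      ENNReal.ofReal (M.expect σ g (n + m) (History.start u)) := by
  induction n generalizing m with
  | zero =>
    rw [M.lintegral_runMeasure_zero σ u (fun h => ENNReal.ofReal (M.expect σ g m h)), zero_add]
  | succ n ih =>
    rw [M.lintegral_runMeasure_pair σ u n (fun x => ENNReal.ofReal (M.expect σ g m x.2))]
    simp only [M.lintegral_ofReal_expect σ hg]
    rw [ih, show n + 1 + m = n + (m + 1) by omega]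

/-- Reduces almost sure statements about runs to combinatorics of paths in the transition graph. -/
lemma ae_exists_prob_ne_zero (M : LabeledMDP V Γ Q) (σ : M.Strategy) (u : V) :
    ∀ᵐ θ ∂M.runMeasure σ u, (θ 0).last = u ∧
      ∀ n, ∃ γ, M.prob (θ n).last γ (θ (n + 1)).last ≠ 0 := by
  have h0 : ∀ᵐ θ ∂M.runMeasure σ u, (θ 0).last = u := by
    classical
    have := M.lintegral_runMeasure_zero σ u (fun h => if h.last = u then 0 else 1)
    have hm : Measurable fun θ : ℕ → History V Γ =>
        if (θ 0).last = u then (0 : ENNReal) else 1 :=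
      measurable_from_top.comp (measurable_pi_apply (X := fun _ => History V Γ) 0)
        (g := fun h : History V Γ => if h.last = u then (0 : ENNReal) else 1)
    rw [if_pos (by rfl), lintegral_eq_zero_iff hm] at this
    filter_upwards [this] with θ hθ
    by_contra hne
    simp [hne] at hθ
  refine h0.and (ae_all_iff.2 fun n => ?_)
  classical
  set f : History V Γ × History V Γ → ENNReal :=
    fun x => if ∃ γ, M.prob x.1.last γ x.2.last ≠ 0 then 0 else 1 with hf
  have := M.lintegral_runMeasure_pair σ u n f
  have hz : ∀ h, ∫⁻ h', f (h, h') ∂M.stepMeasure σ h = 0 := by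
    intro h
    rw [M.lintegral_stepMeasure σ h (fun h' => f (h, h'))]
    refine Finset.sum_eq_zero fun γ _ => Finset.sum_eq_zero fun v' _ => ?_
    by_cases hp : M.prob h.last γ v' = 0
    · simp [hp]
    · have : f (h, h.extend γ v') = 0 := if_pos ⟨γ, hp⟩
      rw [this, mul_zero]
  have hfm : Measurable f := .of_discrete
  simp only [hz, lintegral_zero] at this
  rw [lintegral_eq_zero_iff (by fun_prop)] at this
  filter_upwards [this] with θ hθ
  by_contra hne
  simp only [Pi.zero_apply, hf, if_neg hne] at hθ
  exact one_ne_zero hθ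

/-- If along every path from `u` the predicate `P` is eventually seen exactly if it is seen at
time `K`, the probability of seeing it is a finite horizon expectation. -/
lemma pr_eventually_eq_expect [DecidableEq Q] (M : LabeledMDP V Γ Q) (σ : M.Strategy) (u : V)
    (P : Q) (K : ℕ)
    (hpath : ∀ x : ℕ → V, x 0 = u → (∀ i, ∃ γ, M.prob (x i) γ (x (i + 1)) ≠ 0) →
      ((∃ i, P ∈ M.label (x i)) ↔ P ∈ M.label (x K))) :
    M.pr σ u (eventually P) =
      M.expect σ (fun v => if P ∈ M.label v then 1 else 0) K (History.start u) := by
  set g : V → ℝ := fun v => if P ∈ M.label v then 1 else 0 with hg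
  have hg0 : ∀ v, 0 ≤ g v := fun v => by
    simp only [hg]; split_ifs <;> norm_num
  have h1 : (M.runMeasure σ u) {θ | (fun i => M.label (θ i).last) ∈ eventually P} =
      (M.runMeasure σ u) {θ | P ∈ M.label (θ K).last} := by
    refine measure_congr ?_
    filter_upwards [M.ae_exists_prob_ne_zero σ u] with θ hθ
    exact propext (hpath (fun i => (θ i).last) hθ.1 hθ.2)
  have h2 := M.lintegral_runMeasure_expect σ u hg0 K 0
  have hm : Measurable fun θ : ℕ → History V Γ => θ K :=
    measurable_pi_apply (X := fun _ => History V Γ) K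
  have hms : MeasurableSet {θ : ℕ → History V Γ | P ∈ M.label (θ K).last} :=
    hm (MeasurableSet.of_discrete (s := {h : History V Γ | P ∈ M.label h.last}))
  have h3 : ∀ θ : ℕ → History V Γ, ENNReal.ofReal (M.expect σ g 0 (θ K)) =
      Set.indicator {θ : ℕ → History V Γ | P ∈ M.label (θ K).last} 1 θ := by
    intro θ
    by_cases hθ : P ∈ M.label (θ K).last <;> simp [expect, hg, hθ]
  simp only [h3] at h2
  rw [lintegral_indicator_one hms, add_zero] at h2
  rw [pr, Measure.real, h1, h2, ENNReal.toReal_ofReal (M.expect_nonneg σ hg0 _ _)]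

end LabeledMDP

end MultiObjective

/-! ### Strategies realize exactly the convex hull of the deterministic values -/

namespace MultiObjective

namespace LabeledMDP

variable {V Γ Q : Type} [Fintype V]
variable {E : Type*} [AddCommGroup E] [Module ℝ E]

/-- The values of the deterministic strategies with horizon `m` for the terminal payoff `g`. -/
def detValues (M : LabeledMDP V Γ Q) (g : V → E) : ℕ → V → Set E
  | 0, v => {g v}
  | m + 1, v => {x | ∃ γ ∈ M.enabled v, ∃ f : V → E,
      (∀ v', f v' ∈ detValues M g m v') ∧ ∑ v', (M.prob v γ v' : ℝ) • f v' = x}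

lemma detValues_finite (M : LabeledMDP V Γ Q) (g : V → E) (m : ℕ) (v : V) :
    (M.detValues g m v).Finite := by
  induction m generalizing v with
  | zero => exact Set.finite_singleton _
  | succ m ih =>
    have h : M.detValues g (m + 1) v ⊆ ⋃ γ ∈ M.enabled v,
        (fun f : V → E => ∑ v', (M.prob v γ v' : ℝ) • f v') ''
          Set.univ.pi (fun v' => M.detValues g m v') := by
      rintro x ⟨γ, hγ, f, hf, rfl⟩
      exact Set.mem_biUnion hγ ⟨f, fun v' _ => hf v', rfl⟩
    exact ((M.enabled v).finite_toSet.biUnion fun γ _ =>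
      (Set.Finite.pi fun v' => ih v').image _).subset h

/-- Convex hulls commute with products and with linear images, and the choices at different
successors are independent. -/
lemma sum_smul_mem_convexHull_detValues (M : LabeledMDP V Γ Q) (g : V → E) (m : ℕ) {v : V}
    {γ : Γ} (hγ : γ ∈ M.enabled v) {f : V → E}
    (hf : ∀ v', f v' ∈ convexHull ℝ (M.detValues g m v')) :
    ∑ v', (M.prob v γ v' : ℝ) • f v' ∈ convexHull ℝ (M.detValues g (m + 1) v) := by
  let L : (V → E) →ₗ[ℝ] E := ∑ v', (M.prob v γ v' : ℝ) • LinearMap.proj v'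
  have hL : ∀ f, L f = ∑ v', (M.prob v γ v' : ℝ) • f v' := fun f => by simp [L]
  have h1 : f ∈ convexHull ℝ (Set.univ.pi fun v' => M.detValues g m v') := by
    rw [convexHull_pi]
    exact fun v' _ => hf v'
  rw [← hL]
  have h2 : L f ∈ L '' convexHull ℝ (Set.univ.pi fun v' => M.detValues g m v') := ⟨f, h1, rfl⟩
  rw [LinearMap.image_convexHull] at h2
  refine convexHull_mono ?_ h2
  rintro _ ⟨f', hf', rfl⟩
  exact ⟨γ, hγ, f', fun v' => hf' v' trivial, (hL f').symm⟩

/-- The payoff vector that records which of the predicates hold in a state. -/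
def labelVector {k : ℕ} (M : LabeledMDP V Γ (Fin k)) (v : V) (i : Fin k) : ℝ :=
  if i ∈ M.label v then 1 else 0

lemma labelVector_nonneg {k : ℕ} (M : LabeledMDP V Γ (Fin k)) (v : V) : 0 ≤ M.labelVector v := by
  intro i
  unfold labelVector
  split_ifs <;> simp

lemma detValues_nonneg {k : ℕ} (M : LabeledMDP V Γ (Fin k)) (m : ℕ) (v : V) :
    ∀ r ∈ M.detValues M.labelVector m v, 0 ≤ r := by
  induction m generalizing v with
  | zero => rintro _ rfl; exact M.labelVector_nonneg v
  | succ m ih =>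
    rintro _ ⟨γ, -, f, hf, rfl⟩
    refine Finset.sum_nonneg fun v' _ => smul_nonneg ?_ (ih v' _ (hf v'))
    exact_mod_cast M.prob_nonneg _ _ _

variable [Fintype Γ]

lemma sum_dist_toReal (M : LabeledMDP V Γ Q) (σ : M.Strategy) (h : History V Γ) :
    ∑ γ, (σ.dist h γ).toReal = 1 := by
  rw [← ENNReal.toReal_sum fun γ _ => (σ.dist h).apply_ne_top γ,
    ← tsum_fintype (L := .unconditional _), (σ.dist h).tsum_coe, ENNReal.toReal_one]

lemma expect_mem_convexHull_detValues (M : LabeledMDP V Γ Q) (σ : M.Strategy) (g : V → E) (m : ℕ)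
    (h : History V Γ) : M.expect σ g m h ∈ convexHull ℝ (M.detValues g m h.last) := by
  induction m generalizing h with
  | zero => exact subset_convexHull _ _ rfl
  | succ m ih =>
    have h0 : ∀ γ ∉ M.enabled h.last, (σ.dist h γ).toReal = 0 := by
      intro γ hγ
      have : σ.dist h γ = 0 := by
        by_contra hne
        exact hγ (σ.support_subset h ((PMF.mem_support_iff _ _).2 hne))
      simp [this]
    have h1 : M.expect σ g (m + 1) h = ∑ γ ∈ M.enabled h.last, (σ.dist h γ).toReal •
        ∑ v', (M.prob h.last γ v' : ℝ) • M.expect σ g m (h.extend γ v') := by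
      rw [expect, Finset.sum_subset (Finset.subset_univ (M.enabled h.last))]
      · simp only [Finset.smul_sum, smul_smul]
      · intro γ _ hγ
        rw [h0 γ hγ, zero_smul]
    rw [h1]
    refine (convex_convexHull ℝ _).sum_mem (fun γ _ => ENNReal.toReal_nonneg) ?_ fun γ hγ =>
      M.sum_smul_mem_convexHull_detValues g m hγ fun v' => ih (h.extend γ v')
    rw [← M.sum_dist_toReal σ h]
    exact Finset.sum_subset (Finset.subset_univ _) fun γ _ hγ => h0 γ hγ

/-- The vectors obtained by randomizing the first action and then aiming at hull points form a
convex set containing the deterministic values. For convexity, the two targets attached to an action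
are merged with weights proportional to the probabilities of that action. -/
lemma exists_decomposition (M : LabeledMDP V Γ Q) (g : V → E) (m : ℕ) (v : V) {r : E}
    (hr : r ∈ convexHull ℝ (M.detValues g (m + 1) v)) :
    ∃ (α : Γ → ℝ) (F : Γ → V → E), (∀ γ, 0 ≤ α γ) ∧ ∑ γ, α γ = 1 ∧
      (∀ γ ∉ M.enabled v, α γ = 0) ∧ (∀ γ v', F γ v' ∈ convexHull ℝ (M.detValues g m v')) ∧
      ∑ γ, α γ • ∑ v', (M.prob v γ v' : ℝ) • F γ v' = r := by
  classical
  revert r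
  let C : Set E := {r | ∃ (α : Γ → ℝ) (F : Γ → V → E), (∀ γ, 0 ≤ α γ) ∧ ∑ γ, α γ = 1 ∧
      (∀ γ ∉ M.enabled v, α γ = 0) ∧ (∀ γ v', F γ v' ∈ convexHull ℝ (M.detValues g m v')) ∧
      ∑ γ, α γ • ∑ v', (M.prob v γ v' : ℝ) • F γ v' = r}
  suffices convexHull ℝ (M.detValues g (m + 1) v) ⊆ C from fun r hr => this hr
  refine convexHull_min ?_ ?_
  · rintro _ ⟨γ, hγ, f, hf, rfl⟩
    refine ⟨Pi.single γ 1, fun _ => f, fun γ' => ?_, by simp, fun γ' hγ' => ?_,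
      fun _ v' => subset_convexHull _ _ (hf v'), ?_⟩
    · by_cases h : γ' = γ
      · subst h; simp
      · simp [h]
    · have : γ' ≠ γ := fun h => hγ' (h ▸ hγ)
      simp [this]
    · simp [Pi.single_apply, ite_smul]
  · rintro _ ⟨α, F, hα, hα1, hαe, hF, rfl⟩ _ ⟨β, G, hβ, hβ1, hβe, hG, rfl⟩ a b ha hb hab
    have key : ∀ γ, ∃ H : V → E, (∀ v', H v' ∈ convexHull ℝ (M.detValues g m v')) ∧
        (a * α γ + b * β γ) • H = (a * α γ) • F γ + (b * β γ) • G γ := by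
      intro γ
      have hc : Convex ℝ (Set.univ.pi fun v' => convexHull ℝ (M.detValues g m v')) :=
        convex_pi fun v' _ => convex_convexHull ℝ _
      obtain ⟨H, hH, hH'⟩ := hc.exists_mem_add_smul_eq (x := F γ) (y := G γ)
        (fun v' _ => hF γ v') (fun v' _ => hG γ v') (mul_nonneg ha (hα γ)) (mul_nonneg hb (hβ γ))
      exact ⟨H, fun v' => hH v' trivial, hH'⟩
    choose H hH hH' using key
    refine ⟨fun γ => a * α γ + b * β γ, H, fun γ => ?_, ?_, fun γ hγ => ?_, hH, ?_⟩
    · exact add_nonneg (mul_nonneg ha (hα γ)) (mul_nonneg hb (hβ γ))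
    · rw [Finset.sum_add_distrib, ← Finset.mul_sum, ← Finset.mul_sum, hα1, hβ1, mul_one, mul_one,
        hab]
    · simp [hαe γ hγ, hβe γ hγ]
    · simp only [Finset.smul_sum, ← Finset.sum_add_distrib]
      refine Finset.sum_congr rfl fun γ _ => Finset.sum_congr rfl fun v' _ => ?_
      have := congrFun (hH' γ) v'
      simp only [Pi.smul_apply, Pi.add_apply] at this
      rw [smul_comm, this, smul_add, mul_smul, mul_smul, smul_comm a, smul_comm b,
        smul_comm _ (α γ), smul_comm _ (β γ), smul_comm a (α γ), smul_comm b (β γ),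
        smul_comm a (M.prob v γ v' : ℝ), smul_comm b (M.prob v γ v' : ℝ)]

/-- A total version of `exists_decomposition`, so that `choose` gives functions defined for every
`r`; outside the hull an arbitrary enabled action is played. -/
lemma exists_pmf_decomposition (M : LabeledMDP V Γ Q) (g : V → E) (m : ℕ) (v : V) (r : E) :
    ∃ (α : PMF Γ) (F : Γ → V → E), α.support ⊆ M.enabled v ∧
      (r ∈ convexHull ℝ (M.detValues g (m + 1) v) →
        (∀ γ v', F γ v' ∈ convexHull ℝ (M.detValues g m v')) ∧
        ∑ γ, ∑ v', ((α γ).toReal * (M.prob v γ v' : ℝ)) • F γ v' = r) := by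
  by_cases hr : r ∈ convexHull ℝ (M.detValues g (m + 1) v)
  · obtain ⟨α, F, hα, hα1, hαe, hF, hsum⟩ := M.exists_decomposition g m v hr
    refine ⟨PMF.ofFintype (fun γ => ENNReal.ofReal (α γ)) ?_, F, ?_, fun _ => ⟨hF, ?_⟩⟩
    · rw [← ENNReal.ofReal_sum_of_nonneg fun γ _ => hα γ, hα1, ENNReal.ofReal_one]
    · intro γ hγ
      by_contra hne
      simp [hαe γ hne] at hγ
    · simpa [ENNReal.toReal_ofReal (hα _), Finset.smul_sum, smul_smul] using hsum
  · obtain ⟨γ, hγ⟩ := M.enabled_nonempty v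
    refine ⟨PMF.pure γ, fun _ _ => 0, ?_, fun h => absurd h hr⟩
    simpa using hγ

/-- Every point of the convex hull of the deterministic values is the value of a strategy. -/
lemma exists_strategy_expect_eq (M : LabeledMDP V Γ Q) (g : V → E) (K : ℕ) (u : V) {r₀ : E}
    (hr₀ : r₀ ∈ convexHull ℝ (M.detValues g K u)) :
    ∃ σ : M.Strategy, M.expect σ g K (History.start u) = r₀ := by
  choose α F hsupp hdec using M.exists_pmf_decomposition g
  -- The strategy remembers the remaining horizon and the vector still to be realized, recomputed by
  -- folding over the past. The target is kept as a function of the current state, because the fold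
  -- sees a state only when the next action is played.
  let step : ℕ × (V → E) → V × Γ → ℕ × (V → E) := fun c x =>
    (c.1 - 1, fun v' => F (c.1 - 1) x.1 (c.2 x.1) x.2 v')
  let budget : History V Γ → ℕ := fun h => (h.past.foldl step (K, fun _ => r₀)).1
  let target : History V Γ → E := fun h => (h.past.foldl step (K, fun _ => r₀)).2 h.last
  have hb : ∀ h γ v', budget (h.extend γ v') = budget h - 1 := by
    intro h γ v'
    simp [budget, History.extend, List.foldl_append, step]
  have ht : ∀ h γ v', target (h.extend γ v') = F (budget h - 1) h.last (target h) γ v' := by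
    intro h γ v'
    simp [budget, target, History.extend, List.foldl_append, step]
  let σ : M.Strategy := ⟨fun h => α (budget h - 1) h.last (target h), fun h => hsupp _ _ _⟩
  have main : ∀ m h, budget h = m → target h ∈ convexHull ℝ (M.detValues g m h.last) →
      M.expect σ g m h = target h := by
    intro m
    induction m with
    | zero =>
      intro h _ hh
      simpa [detValues, expect, eq_comm] using hh
    | succ m ih =>
      intro h hm hh
      have hm' : budget h - 1 = m := by omega
      obtain ⟨h1, h2⟩ := hdec m h.last (target h) hh
      rw [expect]
      refine Eq.trans ?_ h2
      refine Finset.sum_congr rfl fun γ _ => Finset.sum_congr rfl fun v' _ => ?_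
      rw [ih (h.extend γ v') (by rw [hb, hm']) (by rw [ht, hm']; exact h1 γ v'), ht, hm']
      simp only [σ, hm']
  exact ⟨σ, main K (History.start u) rfl hr₀⟩

/-- The achievable vectors are the nonnegative vectors below the convex hull of the values of the
deterministic strategies. -/
lemma achievable_eventually_eq {k : ℕ} (M : LabeledMDP V Γ (Fin k)) (u : V) (K : ℕ)
    (hpath : ∀ (P : Fin k) (x : ℕ → V), x 0 = u →
      (∀ i, ∃ γ, M.prob (x i) γ (x (i + 1)) ≠ 0) →
      ((∃ i, P ∈ M.label (x i)) ↔ P ∈ M.label (x K))) :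
    M.achievable u (fun i : Fin k => eventually i) =
      {r | 0 ≤ r ∧ ∃ t ∈ convexHull ℝ (M.detValues M.labelVector K u), r ≤ t} := by
  have hpr : ∀ (σ : M.Strategy) (i : Fin k), M.pr σ u (eventually i) =
      M.expect σ M.labelVector K (History.start u) i := fun σ i => by
    rw [expect_apply, M.pr_eventually_eq_expect σ u i K (hpath i)]
    rfl
  ext r
  constructor
  · rintro ⟨h0, σ, hσ⟩
    exact ⟨h0, _, M.expect_mem_convexHull_detValues σ _ K (History.start u),
      fun i => (hσ i).trans (hpr σ i).le⟩
  · rintro ⟨h0, t, ht, hrt⟩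
    obtain ⟨σ, rfl⟩ := M.exists_strategy_expect_eq _ K u ht
    exact ⟨h0, σ, fun i => (hrt i).trans (hpr σ i).ge⟩

end LabeledMDP

end MultiObjective

namespace MultiObjective

/-! ### Finiteness of vertices and facets -/

section Polygon

/-- The nonnegative vectors below the convex hull of `S`. -/
def lowerHull {k : ℕ} (S : Set (Fin k → ℝ)) : Set (Fin k → ℝ) :=
  {r | 0 ≤ r ∧ ∃ t ∈ convexHull ℝ S, r ≤ t}

variable {k : ℕ} {S : Set (Fin k → ℝ)}

lemma convexHull_subset_lowerHull (h0 : ∀ s ∈ S, 0 ≤ s) : convexHull ℝ S ⊆ lowerHull S := by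
  intro t ht
  exact ⟨convexHull_min (t := Set.Ici 0) h0 (convex_Ici 0) ht, t, ht, le_rfl⟩

lemma paretoCurve_lowerHull_subset (h0 : ∀ s ∈ S, 0 ≤ s) :
    paretoCurve (lowerHull S) ⊆ convexHull ℝ S := by
  rintro r ⟨⟨-, t, ht, hrt⟩, hr⟩
  by_contra hne
  exact hr ⟨t, convexHull_subset_lowerHull h0 ht, hrt, fun h => hne (h ▸ ht)⟩

lemma extremePoints_subset_of_subset_convexHull {F : Set (Fin k → ℝ)}
    (hF : IsExtreme ℝ (lowerHull S) F) (h0 : ∀ s ∈ S, 0 ≤ s) (hFS : F ⊆ convexHull ℝ S) :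
    F.extremePoints ℝ ⊆ S := by
  intro x hx
  exact extremePoints_convexHull_subset (𝕜 := ℝ) (inter_extremePoints_subset_extremePoints_of_subset
    (convexHull_subset_lowerHull h0) ⟨hFS hx.1, hF.extremePoints_subset_extremePoints hx⟩)

lemma finite_paretoVertices_lowerHull (h0 : ∀ s ∈ S, 0 ≤ s) (hS : S.Finite) :
    (paretoVertices (lowerHull S)).Finite := by
  refine hS.subset fun x hx => ?_
  exact extremePoints_convexHull_subset (𝕜 := ℝ) (inter_extremePoints_subset_extremePoints_of_subset
    (convexHull_subset_lowerHull h0) ⟨paretoCurve_lowerHull_subset h0 hx.1, hx.2⟩)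

/-- Pareto points lie in the polytope `convexHull ℝ S`, so a facet is an exposed face of that
compact set; compactness of `lowerHull S` is never needed. -/
lemma isCompact_and_convex_of_mem_paretoFacets (h0 : ∀ s ∈ S, 0 ≤ s) (hS : S.Finite)
    {F : Set (Fin k → ℝ)} (hF : F ∈ paretoFacets (lowerHull S)) : IsCompact F ∧ Convex ℝ F := by
  have hsub : F ⊆ convexHull ℝ S := hF.2.2.2.trans (paretoCurve_lowerHull_subset h0)
  have hexp : IsExposed ℝ (convexHull ℝ S) F :=
    hF.2.1.mono (convexHull_subset_lowerHull h0) hsub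
  exact ⟨hexp.isCompact (hS.isCompact_convexHull ℝ), hexp.convex (convex_convexHull ℝ S)⟩

/-- By Krein–Milman a facet is recovered from its extreme points, which lie in `S`. Hence `F ↦ F ∩
S` is injective on facets, which makes them finite in number. -/
lemma closure_convexHull_inter_of_mem_paretoFacets (h0 : ∀ s ∈ S, 0 ≤ s) (hS : S.Finite)
    {F : Set (Fin k → ℝ)} (hF : F ∈ paretoFacets (lowerHull S)) :
    closure (convexHull ℝ (F ∩ S)) = F := by
  obtain ⟨hc, hconv⟩ := isCompact_and_convex_of_mem_paretoFacets h0 hS hF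
  have hsub : F ⊆ convexHull ℝ S := hF.2.2.2.trans (paretoCurve_lowerHull_subset h0)
  refine (closure_minimal (convexHull_min Set.inter_subset_left hconv) hc.isClosed).antisymm ?_
  nth_rewrite 1 [← closure_convexHull_extremePoints hc hconv]
  exact closure_mono (convexHull_mono fun x hx =>
    ⟨hx.1, extremePoints_subset_of_subset_convexHull hF.2.1.isExtreme h0 hsub hx⟩)

lemma finite_paretoFacets_lowerHull (h0 : ∀ s ∈ S, 0 ≤ s) (hS : S.Finite) :
    (paretoFacets (lowerHull S)).Finite := by
  refine Set.Finite.of_finite_image (f := fun F => F ∩ S)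
    (hS.finite_subsets.subset ?_) fun F hF G hG h => ?_
  · rintro _ ⟨F, -, rfl⟩
    exact Set.inter_subset_right
  · rw [← closure_convexHull_inter_of_mem_paretoFacets h0 hS hF,
      ← closure_convexHull_inter_of_mem_paretoFacets h0 hS hG]
    exact congrArg (fun A => closure (convexHull ℝ A)) h

end Polygon

/-! ### Edges of a planar lower hull and their normal directions -/

section Plane

/-- The weighted sum of the coordinates with the weights `1 - y` and `1 + y`. -/
noncomputable def tilt (y : ℝ) : StrongDual ℝ (Fin 2 → ℝ) :=
  (1 - y) • ContinuousLinearMap.proj 0 + (1 + y) • ContinuousLinearMap.proj 1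

lemma tilt_apply (y : ℝ) (r : Fin 2 → ℝ) : tilt y r = (1 - y) * r 0 + (1 + y) * r 1 := by
  simp [tilt]

lemma eq_of_tilt_eq {y y' : ℝ} (hy : y ≠ y') {r s : Fin 2 → ℝ} (h : tilt y r = tilt y s)
    (h' : tilt y' r = tilt y' s) : r = s := by
  simp only [tilt_apply] at h h'
  have h1 : (y - y') * ((r 1 - r 0) - (s 1 - s 0)) = 0 := by linarith
  have h2 : (r 1 - r 0) - (s 1 - s 0) = 0 := (mul_eq_zero.1 h1).resolve_left (sub_ne_zero.2 hy)
  have h3 : r 0 = s 0 := by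
    have : r 1 = s 1 + r 0 - s 0 := by linarith
    rw [this] at h
    linarith
  ext i
  fin_cases i
  · exact h3
  · change r 1 = s 1
    linarith

lemma tilt_lt_of_le_of_ne {y : ℝ} (hy : y ∈ Set.Ioo (-1 : ℝ) 1) {r s : Fin 2 → ℝ} (h : r ≤ s)
    (hne : r ≠ s) : tilt y r < tilt y s := by
  have h0 := h 0
  have h1 := h 1
  have hy1 : 0 < 1 - y := by linarith [hy.2]
  have hy2 : 0 < 1 + y := by linarith [hy.1]
  rw [tilt_apply, tilt_apply]
  by_contra hlt
  apply hne
  have e0 : (1 - y) * (s 0 - r 0) ≥ 0 := mul_nonneg hy1.le (by linarith)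
  have e1 : (1 + y) * (s 1 - r 1) ≥ 0 := mul_nonneg hy2.le (by linarith)
  have e0' : (1 - y) * (s 0 - r 0) = 0 := by linarith
  have e1' : (1 + y) * (s 1 - r 1) = 0 := by linarith
  ext i
  fin_cases i
  · change r 0 = s 0
    linarith [(mul_eq_zero.1 e0').resolve_left hy1.ne']
  · change r 1 = s 1
    linarith [(mul_eq_zero.1 e1').resolve_left hy2.ne']

variable {S : Set (Fin 2 → ℝ)}

/-- The face of `lowerHull S` in the direction `tilt y`. -/
noncomputable def tiltFace (S : Set (Fin 2 → ℝ)) (y : ℝ) : Set (Fin 2 → ℝ) :=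
  (tilt y).toExposed (lowerHull S)

lemma tilt_eq_of_mem_tiltFace {y : ℝ} {r s : Fin 2 → ℝ} (hr : r ∈ tiltFace S y)
    (hs : s ∈ tiltFace S y) : tilt y r = tilt y s :=
  le_antisymm (hs.2 _ hr.1) (hr.2 _ hs.1)

lemma mem_tiltFace {y : ℝ} (hy : y ∈ Set.Ioo (-1 : ℝ) 1) (h0 : ∀ s ∈ S, 0 ≤ s)
    {s : Fin 2 → ℝ} (hs : s ∈ S) (hmax : ∀ t ∈ S, tilt y t ≤ tilt y s) : s ∈ tiltFace S y := by
  refine ⟨convexHull_subset_lowerHull h0 (subset_convexHull _ _ hs), ?_⟩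
  rintro r ⟨-, t, ht, hrt⟩
  have h1 : tilt y t ≤ tilt y s :=
    convexHull_min (t := {t | tilt y t ≤ tilt y s}) hmax
      (convex_halfSpace_le (tilt y).toLinearMap.isLinear _) ht
  rcases eq_or_ne r t with rfl | hne
  · exact h1
  · exact (tilt_lt_of_le_of_ne hy hrt hne).le.trans h1

/-- The face lies on a level line of `tilt y`, so two distinct points force dimension one; both
weights are positive, so its points are Pareto optimal. -/
lemma tiltFace_mem_paretoFacets {y : ℝ} (hy : y ∈ Set.Ioo (-1 : ℝ) 1)
    (hnt : (tiltFace S y).Nontrivial) : tiltFace S y ∈ paretoFacets (lowerHull S) := by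
  refine ⟨hnt.nonempty, ContinuousLinearMap.toExposed.isExposed, ?_, fun r hr => ⟨hr.1, ?_⟩⟩
  · have hle : vectorSpan ℝ (tiltFace S y) ≤ LinearMap.ker (tilt y).toLinearMap := by
      refine Submodule.span_le.2 ?_
      rintro _ ⟨r, hr, s, hs, rfl⟩
      have := tilt_eq_of_mem_tiltFace hr hs
      change tilt y (r - s) = 0
      rw [map_sub, this, sub_self]
    have hne : vectorSpan ℝ (tiltFace S y) ≠ ⊤ := by
      intro h
      rw [h, top_le_iff] at hle
      have h1 : (fun _ => 1 : Fin 2 → ℝ) ∈ LinearMap.ker (tilt y).toLinearMap := by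
        rw [hle]; trivial
      have h2 : tilt y (fun _ => 1) = 0 := h1
      rw [tilt_apply] at h2
      norm_num at h2
    have hlt := Submodule.finrank_lt hne
    rw [Module.finrank_fin_fun] at hlt
    obtain ⟨r, hr, s, hs, hrs⟩ := hnt
    have hpos : 0 < Module.finrank ℝ (vectorSpan ℝ (tiltFace S y)) := by
      rw [Module.finrank_pos_iff_exists_ne_zero]
      exact ⟨⟨r -ᵥ s, vsub_mem_vectorSpan ℝ hr hs⟩, fun h => hrs (by
        simpa [sub_eq_zero] using congrArg Subtype.val h)⟩
    omega
  · rintro ⟨r', hr', hle, hne⟩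
    exact absurd (hr.2 r' hr') (not_le.2 (tilt_lt_of_le_of_ne hy hle hne))

lemma tiltFace_injOn {Z : Set ℝ} (hnt : ∀ y ∈ Z, (tiltFace S y).Nontrivial) :
    Set.InjOn (tiltFace S) Z := by
  intro y hy y' hy' h
  by_contra hne
  obtain ⟨r, hr, s, hs, hrs⟩ := hnt y hy
  exact hrs (eq_of_tilt_eq hne (tilt_eq_of_mem_tiltFace hr hs)
    (tilt_eq_of_mem_tiltFace (h ▸ hr) (h ▸ hs)))

lemma exists_paretoVertices_of_nontrivial {y : ℝ} (hy : y ∈ Set.Ioo (-1 : ℝ) 1)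
    (h0 : ∀ s ∈ S, 0 ≤ s) (hS : S.Finite) (hnt : (tiltFace S y).Nontrivial) :
    ∃ r s, r ≠ s ∧ (r ∈ paretoVertices (lowerHull S) ∧ s ∈ paretoVertices (lowerHull S)) ∧
      tilt y r = tilt y s := by
  have hF := tiltFace_mem_paretoFacets hy hnt
  obtain ⟨hc, hconv⟩ := isCompact_and_convex_of_mem_paretoFacets h0 hS hF
  have hext := hF.2.1.isExtreme.extremePoints_subset_extremePoints
  have hnt' : ((tiltFace S y).extremePoints ℝ).Nontrivial := by
    by_contra h
    rw [Set.not_nontrivial_iff] at h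
    have hcl := closure_convexHull_extremePoints hc hconv
    rcases h.eq_empty_or_singleton with h | ⟨x, h⟩
    · rw [h] at hcl
      simp only [convexHull_empty, closure_empty] at hcl
      exact hnt.nonempty.ne_empty hcl.symm
    · rw [h, convexHull_singleton, closure_singleton] at hcl
      rw [← hcl] at hnt
      exact Set.not_nontrivial_singleton hnt
  obtain ⟨r, hr, s, hs, hrs⟩ := hnt'
  exact ⟨r, s, hrs, ⟨⟨hF.2.2.2 hr.1, hext hr⟩, hF.2.2.2 hs.1, hext hs⟩,
    tilt_eq_of_mem_tiltFace hr.1 hs.1⟩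

lemma ncard_le_ncard_paretoFacets {Z : Set ℝ} (hZ : Z ⊆ Set.Ioo (-1 : ℝ) 1)
    (h0 : ∀ s ∈ S, 0 ≤ s) (hS : S.Finite) (hnt : ∀ y ∈ Z, (tiltFace S y).Nontrivial) :
    Z.ncard ≤ (paretoFacets (lowerHull S)).ncard :=
  Set.ncard_le_ncard_of_injOn (tiltFace S) (fun y hy => tiltFace_mem_paretoFacets (hZ hy) (hnt y hy))
    (tiltFace_injOn hnt) (finite_paretoFacets_lowerHull h0 hS)

/-- Two distinct endpoints determine the normal direction of their edge, so directions inject into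
pairs of vertices. The resulting square is harmless for the final estimate. -/
lemma ncard_le_ncard_paretoVertices_sq {Z : Set ℝ} (hZ : Z ⊆ Set.Ioo (-1 : ℝ) 1)
    (h0 : ∀ s ∈ S, 0 ≤ s) (hS : S.Finite) (hnt : ∀ y ∈ Z, (tiltFace S y).Nontrivial) :
    Z.ncard ≤ (paretoVertices (lowerHull S)).ncard ^ 2 := by
  have key : ∀ y, ∃ p : (Fin 2 → ℝ) × (Fin 2 → ℝ), y ∈ Z → p.1 ≠ p.2 ∧
      (p.1 ∈ paretoVertices (lowerHull S) ∧ p.2 ∈ paretoVertices (lowerHull S)) ∧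
      tilt y p.1 = tilt y p.2 := by
    intro y
    by_cases hy : y ∈ Z
    · obtain ⟨r, s, h⟩ := exists_paretoVertices_of_nontrivial (hZ hy) h0 hS (hnt y hy)
      exact ⟨(r, s), fun _ => h⟩
    · exact ⟨0, fun h => absurd h hy⟩
  choose p hp using key
  have hfin := finite_paretoVertices_lowerHull h0 hS
  rw [sq, ← Set.ncard_prod]
  refine Set.ncard_le_ncard_of_injOn p (fun y hy => (hp y hy).2.1) ?_ (hfin.prod hfin)
  intro y hy y' hy' h
  by_contra hne
  exact (hp y hy).1 (eq_of_tilt_eq hne (hp y hy).2.2 (h ▸ (hp y' hy').2.2))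

end Plane

end MultiObjective

namespace MultiObjective

/-! ### Zeros of the iterated tent map -/

section TentMap

/-- The tent map on `[-1, 1]`. -/
def tent (y : ℝ) : ℝ := 1 - 2 * |y|

lemma finite_preimage_tent {A : Set ℝ} (hA : A.Finite) : (tent ⁻¹' A).Finite := by
  refine ((hA.image fun z => (1 - z) / 2).union (hA.image fun z => -((1 - z) / 2))).subset ?_
  intro y hy
  rcases abs_choice y with h | h
  · refine Or.inl ⟨tent y, hy, ?_⟩
    simp only [tent, h]; ring
  · refine Or.inr ⟨tent y, hy, ?_⟩
    simp only [tent, h]; ring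

lemma finite_zeros_tent_iterate (k : ℕ) : {y | tent^[k] y = 0}.Finite := by
  induction k with
  | zero => exact Set.finite_singleton (0 : ℝ)
  | succ k ih => exact finite_preimage_tent ih

/-- The zeros of the iterates of the tent map in `(-1, 1)`. -/
noncomputable def tentZeros : ℕ → Finset ℝ
  | 0 => {0}
  | k + 1 => (tentZeros k).image (fun z => (1 - z) / 2) ∪
      (tentZeros k).image (fun z => -((1 - z) / 2))

lemma tentZeros_subset (k : ℕ) : ∀ y ∈ tentZeros k, y ∈ Set.Ioo (-1 : ℝ) 1 := by
  induction k with
  | zero => simp [tentZeros]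
  | succ k ih =>
    intro y hy
    simp only [tentZeros, Finset.mem_union, Finset.mem_image] at hy
    rcases hy with ⟨z, hz, rfl⟩ | ⟨z, hz, rfl⟩ <;> obtain ⟨h1, h2⟩ := ih z hz <;>
      constructor <;> linarith

lemma tent_iterate_eq_zero (k : ℕ) : ∀ y ∈ tentZeros k, tent^[k] y = 0 := by
  induction k with
  | zero => simp [tentZeros]
  | succ k ih =>
    intro y hy
    simp only [tentZeros, Finset.mem_union, Finset.mem_image] at hy
    have key : ∀ z ∈ tentZeros k, tent ((1 - z) / 2) = z := by
      intro z hz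
      have := (tentZeros_subset k z hz).2
      rw [tent, abs_of_nonneg (by linarith)]
      ring
    rcases hy with ⟨z, hz, rfl⟩ | ⟨z, hz, rfl⟩
    · rw [Function.iterate_succ_apply, key z hz, ih z hz]
    · rw [Function.iterate_succ_apply, tent, abs_neg, ← tent, key z hz, ih z hz]

lemma card_tentZeros (k : ℕ) : (tentZeros k).card = 2 ^ k := by
  induction k with
  | zero => simp [tentZeros]
  | succ k ih =>
    rw [tentZeros, Finset.card_union_of_disjoint, Finset.card_image_of_injective,
      Finset.card_image_of_injective, ih]
    · ring
    · intro a b h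
      simp only at h
      linarith
    · intro a b h
      simp only at h
      linarith
    · rw [Finset.disjoint_left]
      intro y hy hy'
      simp only [Finset.mem_image] at hy hy'
      obtain ⟨z, hz, rfl⟩ := hy
      obtain ⟨z', hz', h⟩ := hy'
      linarith [(tentZeros_subset k z hz).2, (tentZeros_subset k z' hz').2]

end TentMap

namespace LabeledMDP

/-! ### Bellman recursion for weighted values -/

section Bellman

variable {V Γ Q : Type} [Fintype V] {E : Type*} [AddCommGroup E] [Module ℝ E]

/-- The optimal value, with horizon `m`, of the terminal payoff `l ∘ g`. -/
noncomputable def optValue (M : LabeledMDP V Γ Q) (g : V → E) (l : E →ₗ[ℝ] ℝ) : ℕ → V → ℝ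
  | 0, v => l (g v)
  | m + 1, v => (M.enabled v).sup' (M.enabled_nonempty v)
      fun γ => ∑ v', (M.prob v γ v' : ℝ) * optValue M g l m v'

/-- With `exists_eq_optValue`, this identifies `optValue` as the support function of the
deterministic values: independent choices at the successors can be maximized separately. -/
lemma le_optValue (M : LabeledMDP V Γ Q) (g : V → E) (l : E →ₗ[ℝ] ℝ) (m : ℕ) (v : V) :
    ∀ s ∈ M.detValues g m v, l s ≤ M.optValue g l m v := by
  induction m generalizing v with
  | zero => rintro _ rfl; exact le_rfl
  | succ m ih =>
    rintro _ ⟨γ, hγ, f, hf, rfl⟩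
    refine le_trans ?_ (Finset.le_sup' (fun γ => ∑ v', (M.prob v γ v' : ℝ) *
      M.optValue g l m v') hγ)
    rw [map_sum]
    refine Finset.sum_le_sum fun v' _ => ?_
    rw [map_smul, smul_eq_mul]
    exact mul_le_mul_of_nonneg_left (ih v' _ (hf v')) (by exact_mod_cast M.prob_nonneg _ _ _)

lemma exists_eq_optValue (M : LabeledMDP V Γ Q) (g : V → E) (l : E →ₗ[ℝ] ℝ) (m : ℕ) (v : V) :
    ∃ s ∈ M.detValues g m v, l s = M.optValue g l m v := by
  induction m generalizing v with
  | zero => exact ⟨_, rfl, rfl⟩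
  | succ m ih =>
    obtain ⟨γ, hγ, h⟩ := Finset.exists_mem_eq_sup' (M.enabled_nonempty v)
      (fun γ => ∑ v', (M.prob v γ v' : ℝ) * M.optValue g l m v')
    choose f hf hf' using ih
    refine ⟨_, ⟨γ, hγ, f, hf, rfl⟩, ?_⟩
    rw [optValue, h, map_sum]
    exact Finset.sum_congr rfl fun v' _ => by rw [map_smul, smul_eq_mul, hf' v']

end Bellman

end LabeledMDP

/-! ### The tent MDP, its size and its values -/

section TentMDP

/-- The three possible successors of the state `v` under the action `γ`. The states `3 k + 1`,
`3 k + 2`, `3 k + 3` form the `k`-th level, the state `0` is a sink. -/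
def successor (v : ℕ) (γ : Fin 2) : Fin 3 → ℕ :=
  if v ≤ 3 then fun _ => v
  else if v % 3 = 1 then ![v - 3, v - 2, v - 1]
  else if v % 3 = 2 then ![if γ = 0 then v - 4 else v - 3, if γ = 0 then v - 4 else v - 3, 0]
  else ![0, 0, v - 3]

lemma successor_of_le {v : ℕ} (hv : v ≤ 3) (γ : Fin 2) (i : Fin 3) : successor v γ i = v := by
  simp [successor, hv]

lemma successor_lt {v : ℕ} (hv : 3 < v) (γ : Fin 2) (i : Fin 3) : successor v γ i < v := by
  unfold successor
  rw [if_neg (by omega)]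
  split_ifs <;> fin_cases i <;> simp <;> omega

lemma successor_le (v : ℕ) (γ : Fin 2) (i : Fin 3) : successor v γ i ≤ v := by
  rcases le_or_gt v 3 with hv | hv
  · exact (successor_of_le hv γ i).le
  · exact (successor_lt hv γ i).le

lemma successor_one (k : ℕ) (γ : Fin 2) :
    successor (3 * k + 4) γ = ![3 * k + 1, 3 * k + 2, 3 * k + 3] := by
  rw [successor, if_neg (by omega), if_pos (by omega)]
  rfl

lemma successor_two (k : ℕ) (γ : Fin 2) :
    successor (3 * k + 5) γ =
      ![if γ = 0 then 3 * k + 1 else 3 * k + 2, if γ = 0 then 3 * k + 1 else 3 * k + 2, 0] := by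
  rw [successor, if_neg (by omega), if_neg (by omega), if_pos (by omega)]
  rfl

lemma successor_three (k : ℕ) (γ : Fin 2) : successor (3 * k + 6) γ = ![0, 0, 3 * k + 3] := by
  rw [successor, if_neg (by omega), if_neg (by omega), if_neg (by omega)]
  rfl

/-- The probabilities of the three successors. -/
def slotWeight : Fin 3 → ℚ := ![2 / 5, 2 / 5, 1 / 5]

@[simp] lemma slotWeight_zero : slotWeight 0 = 2 / 5 := rfl

@[simp] lemma slotWeight_one : slotWeight 1 = 2 / 5 := rfl

@[simp] lemma slotWeight_two : slotWeight 2 = 1 / 5 := rfl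

lemma slotWeight_nonneg (i : Fin 3) : 0 ≤ slotWeight i := by
  fin_cases i <;> norm_num [slotWeight]

lemma sum_slotWeight : ∑ i, slotWeight i = 1 := by
  norm_num [Fin.sum_univ_three]

/-- The `i`-th successor as a state of the MDP with `n` states. -/
def nextState {n : ℕ} (v : Fin n) (γ : Fin 2) (i : Fin 3) : Fin n :=
  ⟨successor v γ i, (successor_le v γ i).trans_lt v.2⟩

/-- The MDP with `n` states whose value functions are built from iterates of the tent map. -/
def tentMDP (n : ℕ) : LabeledMDP (Fin n) (Fin 2) (Fin 2) where
  enabled _ := Finset.univ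
  enabled_nonempty _ := Finset.univ_nonempty
  -- Slots may share a successor, so their weights add up: 4/5 for a choice, 1 at an absorbing
  -- state.
  prob v γ v' := ∑ i, if nextState v γ i = v' then slotWeight i else 0
  prob_nonneg v γ v' := Finset.sum_nonneg fun i _ => by
    split_ifs
    · exact slotWeight_nonneg i
    · exact le_rfl
  prob_sum v γ _ := by
    rw [Finset.sum_comm]
    simpa using sum_slotWeight
  prob_disabled v γ v' h := absurd (Finset.mem_univ γ) h
  label v := if (v : ℕ) = 1 then {1} else if (v : ℕ) = 2 then {0}
    else if (v : ℕ) = 3 then Finset.univ else ∅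

lemma sum_prob_smul {E : Type*} [AddCommGroup E] [Module ℝ E] {n : ℕ} (v : Fin n) (γ : Fin 2)
    (f : Fin n → E) : ∑ v', ((tentMDP n).prob v γ v' : ℝ) • f v' =
      ∑ i, (slotWeight i : ℝ) • f (nextState v γ i) := by
  have h : ∀ v', ((tentMDP n).prob v γ v' : ℝ) • f v' =
      ∑ i, if nextState v γ i = v' then (slotWeight i : ℝ) • f v' else 0 := by
    intro v'
    simp only [tentMDP]
    rw [Rat.cast_sum, Finset.sum_smul]
    refine Finset.sum_congr rfl fun i _ => ?_
    split_ifs <;> simp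
  simp only [h]
  rw [Finset.sum_comm]
  simp

lemma exists_nextState_of_prob_ne_zero {n : ℕ} {v v' : Fin n} {γ : Fin 2}
    (h : (tentMDP n).prob v γ v' ≠ 0) : ∃ i, nextState v γ i = v' := by
  obtain ⟨i, -, hi⟩ := Finset.exists_ne_zero_of_sum_ne_zero (s := Finset.univ)
    (f := fun i => if nextState v γ i = v' then slotWeight i else 0) h
  exact ⟨i, by_contra fun hne => hi (if_neg hne)⟩

lemma le_three_of_mem_label {n : ℕ} {v : Fin n} {P : Fin 2} (h : P ∈ (tentMDP n).label v) :
    (v : ℕ) ≤ 3 := by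
  by_contra hv
  have h1 : (v : ℕ) ≠ 1 := by omega
  have h2 : (v : ℕ) ≠ 2 := by omega
  have h3 : (v : ℕ) ≠ 3 := by omega
  simp [tentMDP, h1, h2, h3] at h

/-- States above 3 are unlabeled and strictly decrease along a path, while states up to 3 are
absorbing; so after `n` steps the path has settled for good. -/
lemma exists_mem_label_iff {n : ℕ} (P : Fin 2) (x : ℕ → Fin n)
    (hx : ∀ i, ∃ γ, (tentMDP n).prob (x i) γ (x (i + 1)) ≠ 0) :
    (∃ i, P ∈ (tentMDP n).label (x i)) ↔ P ∈ (tentMDP n).label (x n) := by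
  have hstep : ∀ i, ∃ γ j, nextState (x i) γ j = x (i + 1) := fun i => by
    obtain ⟨γ, hγ⟩ := hx i
    exact ⟨γ, exists_nextState_of_prob_ne_zero hγ⟩
  have hstay : ∀ i, (x i : ℕ) ≤ 3 → ∀ j, x (i + j) = x i := by
    intro i hi j
    induction j with
    | zero => rfl
    | succ j ih =>
      obtain ⟨γ, s, h⟩ := hstep (i + j)
      rw [← add_assoc, ← h, ih]
      exact Fin.ext (successor_of_le hi γ s)
  have hdec : ∀ i, (x i : ℕ) ≤ 3 ∨ (x i : ℕ) + i ≤ x 0 := by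
    intro i
    induction i with
    | zero => exact Or.inr le_rfl
    | succ i ih =>
      rcases le_or_gt (x i : ℕ) 3 with hi | hi
      · exact Or.inl (by rw [hstay i hi 1]; exact hi)
      · obtain ⟨γ, s, h⟩ := hstep i
        have h1 : (x (i + 1) : ℕ) < x i := by
          rw [← h]
          exact successor_lt hi γ s
        right
        omega
  have hn : (x n : ℕ) ≤ 3 := by
    have := (x 0).2
    rcases hdec n with h | h <;> omega
  refine ⟨?_, fun h => ⟨n, h⟩⟩
  rintro ⟨i, hi⟩
  rcases le_total i n with hin | hin
  · obtain ⟨j, rfl⟩ := Nat.exists_eq_add_of_le hin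
    have := hstay i (le_three_of_mem_label hi) j
    rwa [this]
  · obtain ⟨j, rfl⟩ := Nat.exists_eq_add_of_le hin
    rwa [hstay n hn j] at hi

lemma ratBits_sum_slotWeight_le (b : Fin 3 → Prop) [∀ i, Decidable (b i)] :
    ratBits (∑ i, if b i then slotWeight i else 0) ≤ 6 := by
  have key : ∀ q : ℚ, (∃ k : ℕ, k ≤ 5 ∧ q = k / 5) → ratBits q ≤ 6 := by
    rintro _ ⟨k, hk, rfl⟩
    have h1 : ((k : ℚ) / 5).num.natAbs.size ≤ 3 := by
      rw [Nat.size_le]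
      interval_cases k <;> norm_num
    have h2 : ((k : ℚ) / 5).den.size ≤ 3 := by
      rw [Nat.size_le]
      interval_cases k <;> norm_num
    unfold ratBits
    omega
  apply key
  by_cases h0 : b 0 <;> by_cases h1 : b 1 <;> by_cases h2 : b 2 <;>
    simp only [Fin.sum_univ_three, h0, h1, h2, if_true, if_false, slotWeight_zero,
      slotWeight_one, slotWeight_two]
  · exact ⟨5, by norm_num, by norm_num⟩
  · exact ⟨4, by norm_num, by norm_num⟩
  · exact ⟨3, by norm_num, by norm_num⟩
  · exact ⟨2, by norm_num, by norm_num⟩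
  · exact ⟨3, by norm_num, by norm_num⟩
  · exact ⟨2, by norm_num, by norm_num⟩
  · exact ⟨1, by norm_num, by norm_num⟩
  · exact ⟨0, by norm_num, by norm_num⟩

lemma size_tentMDP_le (n : ℕ) : (tentMDP n).size ≤ 45 * n := by
  have h1 : ∀ v, 1 + ((tentMDP n).label v).card ≤ 3 := by
    intro v
    have := Finset.card_le_univ ((tentMDP n).label v)
    simp only [Fintype.card_fin] at this
    omega
  have h2 : ∀ v γ, (∑ v', if (tentMDP n).prob v γ v' = 0 then 0
      else 1 + ratBits ((tentMDP n).prob v γ v')) ≤ 21 := by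
    intro v γ
    -- Each transition is charged to one of its slots: 1 for the transition and at most 6 bits, as
    -- all probabilities are multiples of 1/5.
    calc _ ≤ ∑ v', ∑ i, if nextState v γ i = v' then 7 else 0 := by
          refine Finset.sum_le_sum fun v' _ => ?_
          split_ifs with h
          · exact Nat.zero_le _
          · obtain ⟨i, hi⟩ := exists_nextState_of_prob_ne_zero h
            have hb : ratBits ((tentMDP n).prob v γ v') ≤ 6 :=
              ratBits_sum_slotWeight_le fun i => nextState v γ i = v'
            have hs := Finset.single_le_sum (s := Finset.univ)
              (f := fun i => if nextState v γ i = v' then 7 else 0)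
              (fun _ _ => Nat.zero_le _) (Finset.mem_univ i)
            simp only [hi, if_true] at hs
            omega
      _ = 21 := by
          rw [Finset.sum_comm]
          simp
  calc (tentMDP n).size ≤ ∑ _v : Fin n, 3 + ∑ _v : Fin n, ∑ _γ : Fin 2, 21 :=
        Nat.add_le_add (Finset.sum_le_sum fun v _ => h1 v)
          (Finset.sum_le_sum fun v _ => Finset.sum_le_sum fun γ _ => h2 v γ)
    _ = 45 * n := by simp; ring

/-- The optimal value of the state `v` with horizon `m` in the direction `tilt y`. -/
noncomputable def tentValue (y : ℝ) : ℕ → ℕ → ℝ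
  | 0, v => if v = 1 then 1 + y else if v = 2 then 1 - y else if v = 3 then 2 else 0
  | m + 1, v => max (∑ i, (slotWeight i : ℝ) * tentValue y m (successor v 0 i))
      (∑ i, (slotWeight i : ℝ) * tentValue y m (successor v 1 i))

lemma optValue_tentMDP {n : ℕ} (y : ℝ) (m : ℕ) (v : Fin n) :
    (tentMDP n).optValue (tentMDP n).labelVector (tilt y).toLinearMap m v = tentValue y m v := by
  induction m generalizing v with
  | zero =>
    change tilt y _ = _
    rw [tilt_apply, tentValue]
    simp only [LabeledMDP.labelVector, tentMDP]
    split_ifs <;> simp_all; norm_num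
  | succ m ih =>
    have h : ∀ γ, ∑ v', ((tentMDP n).prob v γ v' : ℝ) *
        (tentMDP n).optValue (tentMDP n).labelVector (tilt y).toLinearMap m v' =
        ∑ i, (slotWeight i : ℝ) * tentValue y m (successor v γ i) := by
      intro γ
      have := sum_prob_smul v γ
        ((tentMDP n).optValue (tentMDP n).labelVector (tilt y).toLinearMap m)
      simp only [smul_eq_mul, ih] at this ⊢
      exact this
    rw [LabeledMDP.optValue, tentValue]
    simp only [h]
    apply le_antisymm
    · refine Finset.sup'_le _ _ fun γ _ => ?_
      fin_cases γ
      · exact le_max_left _ _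
      · exact le_max_right _ _
    · exact max_le (Finset.le_sup' (fun γ => ∑ i, (slotWeight i : ℝ) *
        tentValue y m (successor v γ i)) (Finset.mem_univ 0))
        (Finset.le_sup' (fun γ => ∑ i, (slotWeight i : ℝ) *
        tentValue y m (successor v γ i)) (Finset.mem_univ 1))

lemma tentValue_succ (y : ℝ) (m v : ℕ) : tentValue y (m + 1) v =
    max (2 / 5 * tentValue y m (successor v 0 0) + 2 / 5 * tentValue y m (successor v 0 1) +
        1 / 5 * tentValue y m (successor v 0 2))
      (2 / 5 * tentValue y m (successor v 1 0) + 2 / 5 * tentValue y m (successor v 1 1) +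
        1 / 5 * tentValue y m (successor v 1 2)) := by
  simp [tentValue, Fin.sum_univ_three]

lemma tentValue_of_le (y : ℝ) (m : ℕ) {v : ℕ} (hv : v ≤ 3) :
    tentValue y m v = tentValue y 0 v := by
  induction m with
  | zero => rfl
  | succ m ih =>
    rw [tentValue_succ]
    simp only [successor_of_le hv, ih, max_self]
    ring

lemma tentValue_zero (y : ℝ) (m : ℕ) : tentValue y m 0 = 0 := by
  rw [tentValue_of_le y m (by norm_num)]
  simp [tentValue]

/-- The heart of the construction: with `max A B = (A + B + |A - B|) / 2`, the sums `A + B` cancel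
in the new difference, and the third state supplies the constant term of the tent map at the right
scale. -/
lemma tentValue_level (y : ℝ) (k m : ℕ) (hkm : k ≤ m) :
    tentValue y m (3 * k + 1) - tentValue y m (3 * k + 2) = 2 / 5 ^ k * tent^[k] y ∧
      tentValue y m (3 * k + 3) = 2 / 5 ^ k := by
  induction k generalizing m with
  | zero =>
    rw [tentValue_of_le y m (by norm_num), tentValue_of_le y m (by norm_num),
      tentValue_of_le y m (by norm_num)]
    norm_num [tentValue]
    ring
  | succ k ih =>
    obtain ⟨m, rfl⟩ := Nat.exists_eq_add_of_le' (Nat.one_le_of_lt hkm)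
    obtain ⟨h1, h2⟩ := ih m (by omega)
    set A := tentValue y m (3 * k + 1)
    set B := tentValue y m (3 * k + 2)
    have hA : tentValue y (m + 1) (3 * (k + 1) + 1) = 2 / 5 * A + 2 / 5 * B + 1 / 5 *
        (2 / 5 ^ k) := by
      rw [show 3 * (k + 1) + 1 = 3 * k + 4 by ring, tentValue_succ]
      simp [successor_one, h2, A, B]
    have hB : tentValue y (m + 1) (3 * (k + 1) + 2) = 4 / 5 * max A B := by
      rw [show 3 * (k + 1) + 2 = 3 * k + 5 by ring, tentValue_succ]
      simp only [successor_two, tentValue_zero, if_true, Matrix.cons_val_zero,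
        Matrix.cons_val_one, Matrix.cons_val, one_ne_zero, if_false]
      rw [mul_max_of_nonneg _ _ (by norm_num)]
      congr 1 <;> ring
    have hC : tentValue y (m + 1) (3 * (k + 1) + 3) = 1 / 5 * (2 / 5 ^ k) := by
      rw [show 3 * (k + 1) + 3 = 3 * k + 6 by ring, tentValue_succ]
      simp [successor_three, h2, tentValue_zero]
    have hp : (0 : ℝ) < 2 / 5 ^ k := by positivity
    have habs : |A - B| = 2 / 5 ^ k * |tent^[k] y| := by rw [h1, abs_mul, abs_of_pos hp]
    have hmax : max A B = (A + B + |A - B|) / 2 := by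
      rcases le_total A B with h | h
      · rw [max_eq_right h, abs_of_nonpos (by linarith)]; ring
      · rw [max_eq_left h, abs_of_nonneg (by linarith)]; ring
    constructor
    · rw [hA, hB, hmax, habs, Function.iterate_succ_apply', tent]
      rw [pow_succ]
      field_simp
      ring
    · rw [hC, pow_succ]
      field_simp

/-! ### From kinks of the value function to facets -/

lemma sum_prob_smul_choice {n k : ℕ} (hn : 3 * k + 5 < n) (γ : Fin 2) (f : Fin n → Fin 2 → ℝ) :
    ∑ v', ((tentMDP n).prob ⟨3 * k + 5, hn⟩ γ v' : ℝ) • f v' =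
      (4 / 5 : ℝ) • f ⟨if γ = 0 then 3 * k + 1 else 3 * k + 2, by split_ifs <;> omega⟩ +
        (1 / 5 : ℝ) • f ⟨0, by omega⟩ := by
  have h0 : nextState (⟨3 * k + 5, hn⟩ : Fin n) γ 0 =
      ⟨if γ = 0 then 3 * k + 1 else 3 * k + 2, by split_ifs <;> omega⟩ :=
    Fin.ext (congrFun (successor_two k γ) 0)
  have h1 : nextState (⟨3 * k + 5, hn⟩ : Fin n) γ 1 =
      ⟨if γ = 0 then 3 * k + 1 else 3 * k + 2, by split_ifs <;> omega⟩ :=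
    Fin.ext (congrFun (successor_two k γ) 1)
  have h2 : nextState (⟨3 * k + 5, hn⟩ : Fin n) γ 2 = ⟨0, by omega⟩ :=
    Fin.ext (congrFun (successor_two k γ) 2)
  rw [sum_prob_smul, Fin.sum_univ_three, h0, h1, h2, ← add_smul]
  norm_num

/-- A strict maximum over a finite set persists under small changes of the direction, so a unique
maximizer makes the support function linear near `y`. -/
lemma eventually_eq_tilt_of_unique_maximizer {S : Set (Fin 2 → ℝ)} (hS : S.Finite) {V : ℝ → ℝ} {y : ℝ}
    {s : Fin 2 → ℝ} (hs : s ∈ S) (hle : ∀ z, ∀ t ∈ S, tilt z t ≤ V z)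
    (hex : ∀ z, ∃ t ∈ S, tilt z t = V z) (huniq : ∀ t ∈ S, tilt y t = V y → t = s) :
    ∀ᶠ z in nhds y, V z = tilt z s := by
  have hsy : tilt y s = V y := by
    obtain ⟨t, ht, h⟩ := hex y
    rwa [huniq t ht h] at h
  have h : ∀ᶠ z in nhds y, ∀ t ∈ S, tilt z t ≤ tilt z s := by
    rw [Filter.eventually_all_finite hS]
    intro t ht
    rcases eq_or_ne t s with rfl | hne
    · exact Filter.Eventually.of_forall fun _ => le_rfl
    · have hlt : tilt y t < tilt y s :=
        hsy ▸ lt_of_le_of_ne (hle y t ht) fun h => hne (huniq t ht h)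
      have hc : ∀ r : Fin 2 → ℝ, Continuous fun z => tilt z r := by
        intro r
        simp only [tilt_apply]
        fun_prop
      exact ((hc t).continuousAt.eventually_lt (hc s).continuousAt hlt).mono fun _ h => h.le
  filter_upwards [h] with z hz
  obtain ⟨t, ht, h⟩ := hex z
  exact le_antisymm (h ▸ hz t ht) (hle z s hs)

lemma tiltFace_nontrivial {n k m : ℕ} (hn : 3 * k + 5 < n) (hkm : k ≤ m) {y : ℝ}
    (hy : y ∈ Set.Ioo (-1 : ℝ) 1) (hzero : tent^[k] y = 0) :
    (tiltFace ((tentMDP n).detValues (tentMDP n).labelVector (m + 1) ⟨3 * k + 5, hn⟩)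
      y).Nontrivial := by
  set M := tentMDP n with hM
  set g := M.labelVector with hg
  have hle : ∀ z (v : Fin n), ∀ t ∈ M.detValues g m v, tilt z t ≤ tentValue z m v := by
    intro z v t ht
    rw [← optValue_tentMDP z m v]
    exact M.le_optValue g (tilt z).toLinearMap m v t ht
  have hex : ∀ z (v : Fin n), ∃ t ∈ M.detValues g m v, tilt z t = tentValue z m v := by
    intro z v
    rw [← optValue_tentMDP z m v]
    exact M.exists_eq_optValue g (tilt z).toLinearMap m v
  let c : Fin 2 → Fin n := fun γ =>
    ⟨if γ = 0 then 3 * k + 1 else 3 * k + 2, by split_ifs <;> omega⟩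
  have hc0 : ∀ γ, c γ ≠ ⟨0, by omega⟩ := by
    intro γ h
    have := congrArg Fin.val h
    simp only [c] at this
    split_ifs at this
  have heq : ∀ γ, tentValue y m (c γ) = tentValue y m (3 * k + 1) := by
    intro γ
    have := (tentValue_level y k m hkm).1
    rw [hzero, mul_zero, sub_eq_zero] at this
    by_cases hγ : γ = 0
    · simp [c, hγ]
    · simp [c, hγ, this]
  choose f hf hf' using hex y
  -- The two values of the level agree at `y`, so either action followed by any optimal continuation
  -- is optimal at the choice state.
  have hmem : ∀ γ, ∀ t ∈ M.detValues g m (c γ), tilt y t = tentValue y m (c γ) →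
      (4 / 5 : ℝ) • t + (1 / 5 : ℝ) • f ⟨0, by omega⟩ ∈
        tiltFace (M.detValues g (m + 1) ⟨3 * k + 5, hn⟩) y := by
    intro γ t ht hty
    refine mem_tiltFace hy (M.detValues_nonneg _ _)
      ⟨γ, Finset.mem_univ γ, Function.update f (c γ) t, fun v' => ?_, ?_⟩ ?_
    · by_cases h : v' = c γ
      · subst h; simpa using ht
      · simpa [h] using hf v'
    · rw [sum_prob_smul_choice hn γ, Function.update_of_ne (hc0 γ).symm]
      rw [show (⟨if γ = 0 then 3 * k + 1 else 3 * k + 2, by split_ifs <;> omega⟩ : Fin n) = c γ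
        from rfl, Function.update_self]
    · rintro _ ⟨γ', -, f', hf1, rfl⟩
      rw [sum_prob_smul_choice hn γ', map_add, map_add, map_smul, map_smul, map_smul, map_smul,
        hty, heq γ, ← heq γ', hf']
      have e1 := hle y _ _ (hf1 (c γ'))
      have e2 := hle y _ _ (hf1 ⟨0, by omega⟩)
      simp only [smul_eq_mul]
      exact add_le_add (mul_le_mul_of_nonneg_left e1 (by norm_num))
        (mul_le_mul_of_nonneg_left e2 (by norm_num))
  by_contra hnt
  rw [Set.not_nontrivial_iff] at hnt
  have huniq : ∀ γ γ', ∀ t ∈ M.detValues g m (c γ), tilt y t = tentValue y m (c γ) →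
      ∀ t' ∈ M.detValues g m (c γ'), tilt y t' = tentValue y m (c γ') → t = t' := by
    intro γ γ' t ht hty t' ht' hty'
    have := hnt (hmem γ t ht hty) (hmem γ' t' ht' hty')
    exact smul_right_injective _ (by norm_num : (4 / 5 : ℝ) ≠ 0) (add_right_cancel this)
  have hev : ∀ γ, ∀ᶠ z in nhds y, tentValue z m (c γ) = tilt z (f (c 0)) := by
    intro γ
    have hsame : f (c γ) = f (c 0) := huniq γ 0 _ (hf _) (hf' _) _ (hf _) (hf' _)
    refine eventually_eq_tilt_of_unique_maximizer (V := fun z => tentValue z m (c γ))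
      (M.detValues_finite g m (c γ)) (hsame ▸ hf (c γ))
      (fun z => hle z _) (fun z => hex z _) fun t ht hty => ?_
    exact huniq γ 0 t ht hty _ (hf _) (hf' _)
  -- The other zeros form a finite, hence closed set. Together with `hev`, which forces zeros
  -- throughout a neighbourhood, this would make `y` an isolated point of the line.
  have hclosed : ∀ᶠ z in nhds y, z ∉ {z | tent^[k] z = 0} \ {y} :=
    ((finite_zeros_tent_iterate k).sdiff).isClosed.isOpen_compl.mem_nhds (by simp)
  have hsingle : ∀ᶠ z in nhds y, z = y := by
    filter_upwards [hev 0, hev 1, hclosed] with z h0 h1 hz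
    have h2 := (tentValue_level z k m hkm).1
    have e0 : tentValue z m (3 * k + 1) = tilt z (f (c 0)) := h0
    have e1 : tentValue z m (3 * k + 2) = tilt z (f (c 0)) := h1
    rw [e0, e1, sub_self, eq_comm, mul_eq_zero] at h2
    have h3 : tent^[k] z = 0 := h2.resolve_left (by positivity)
    by_contra hne
    exact hz ⟨h3, hne⟩
  have : ∀ᶠ z in nhdsWithin y {y}ᶜ, False := by
    filter_upwards [hsingle.filter_mono nhdsWithin_le_nhds, self_mem_nhdsWithin] with z h1 h2
    exact h2 h1
  exact (Filter.eventually_false_iff_eq_bot.1 this ▸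
    (inferInstance : (nhdsWithin y {y}ᶜ).NeBot)).ne rfl

lemma pareto_tentMDP {n k : ℕ} (hn : 3 * k + 5 < n) :
    2 ^ k ≤ (paretoVertices ((tentMDP n).achievable ⟨3 * k + 5, hn⟩
        (fun i : Fin 2 => eventually i))).ncard ^ 2 ∧
      2 ^ k ≤ (paretoFacets ((tentMDP n).achievable ⟨3 * k + 5, hn⟩
        (fun i : Fin 2 => eventually i))).ncard := by
  have hU : (tentMDP n).achievable ⟨3 * k + 5, hn⟩ (fun i : Fin 2 => eventually i) =
      lowerHull ((tentMDP n).detValues (tentMDP n).labelVector n ⟨3 * k + 5, hn⟩) :=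
    (tentMDP n).achievable_eventually_eq _ n fun P x _ hx => exists_mem_label_iff P x hx
  have h0 := (tentMDP n).detValues_nonneg n ⟨3 * k + 5, hn⟩
  have hS := (tentMDP n).detValues_finite (tentMDP n).labelVector n ⟨3 * k + 5, hn⟩
  have hZ : (tentZeros k : Set ℝ) ⊆ Set.Ioo (-1 : ℝ) 1 := tentZeros_subset k
  have hcard : (tentZeros k : Set ℝ).ncard = 2 ^ k := by
    rw [Set.ncard_coe_finset, card_tentZeros]
  have hnt : ∀ y ∈ (tentZeros k : Set ℝ), (tiltFace ((tentMDP n).detValues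
      (tentMDP n).labelVector n ⟨3 * k + 5, hn⟩) y).Nontrivial := by
    intro y hy
    obtain ⟨m, hm⟩ : ∃ m, n = m + 1 := ⟨n - 1, by omega⟩
    rw [show (tentMDP n).detValues (tentMDP n).labelVector n =
      (tentMDP n).detValues (tentMDP n).labelVector (m + 1) by rw [← hm]]
    exact tiltFace_nontrivial hn (by omega) (hZ hy) (tent_iterate_eq_zero k y hy)
  rw [hU, ← hcard]
  exact ⟨ncard_le_ncard_paretoVertices_sq hZ h0 hS hnt, ncard_le_ncard_paretoFacets hZ h0 hS hnt⟩

/-- From `log n ≤ 2 √n`, the exponent `2 c (log n)²` of the left side is at most `8 c n ≤ 48 c k`.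
This equals `k / 2`, below `k log 2`, for `c = 1 / 96`. -/
lemma rpow_log_sq_le {n k : ℕ} (hn : 1 ≤ n) (hk : n ≤ 6 * k) :
    ((n : ℝ) ^ (1 / 96 * Real.log n)) ^ 2 ≤ 2 ^ k := by
  have hn0 : (0 : ℝ) < n := by exact_mod_cast hn
  have hlog : Real.log n ≤ 2 * Real.sqrt n := by
    have := Real.log_le_rpow_div hn0.le (by norm_num : (0 : ℝ) < 1 / 2)
    rw [← Real.sqrt_eq_rpow] at this
    linarith
  have hlog0 : 0 ≤ Real.log n := Real.log_nonneg (by exact_mod_cast hn)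
  have hsq : Real.log n * Real.log n ≤ 4 * n := by
    have h1 := mul_self_le_mul_self hlog0 hlog
    have h2 := Real.mul_self_sqrt hn0.le
    nlinarith
  have hk' : (n : ℝ) ≤ 6 * k := by exact_mod_cast hk
  have hl2 : (1 : ℝ) / 2 ≤ Real.log 2 := by linarith [Real.log_two_gt_d9]
  have hk0 : (0 : ℝ) ≤ k := Nat.cast_nonneg k
  rw [Real.rpow_def_of_pos hn0, ← Real.exp_nat_mul, ← Real.rpow_natCast 2 k,
    Real.rpow_def_of_pos (by norm_num)]
  apply Real.exp_le_exp.2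
  have : (1 : ℝ) / 2 * k ≤ Real.log 2 * k := mul_le_mul_of_nonneg_right hl2 hk0
  push_cast
  linarith

end TentMDP

end MultiObjective

/-- Finiteness is implicit: `ncard` of an infinite set is 0, while the lower bounds are positive. -/
theorem mainTheorem5 :
    ∃ (m : ℕ → ℕ) (M : ∀ n : ℕ, MultiObjective.LabeledMDP (Fin n) (Fin (m n)) (Fin 2)),
      (∃ C : ℝ, ∀ n : ℕ, ((M n).size : ℝ) ≤ C * n) ∧
      ∃ (c : ℝ) (n₀ : ℕ), 0 < c ∧ ∀ n : ℕ, n₀ ≤ n → ∃ u : Fin n,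
        (n : ℝ) ^ (c * Real.log n) ≤
          ((MultiObjective.paretoVertices
            ((M n).achievable u (fun i : Fin 2 => MultiObjective.eventually i))).ncard : ℝ) ∧
        (n : ℝ) ^ (c * Real.log n) ≤
          ((MultiObjective.paretoFacets
            ((M n).achievable u (fun i : Fin 2 => MultiObjective.eventually i))).ncard : ℝ) := by
  refine ⟨fun _ => 2, MultiObjective.tentMDP, ⟨45, fun n => ?_⟩, 1 / 96, 16, by norm_num,
    fun n hn => ?_⟩
  · exact_mod_cast MultiObjective.size_tentMDP_le n
  -- The largest `k` for which the choice state `3 * k + 5` exists; `n ≥ 16` ensures `n ≤ 6 * k`.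
  have hu : 3 * ((n - 6) / 3) + 5 < n := by omega
  obtain ⟨h1, h2⟩ := MultiObjective.pareto_tentMDP hu
  have hb := MultiObjective.rpow_log_sq_le (n := n) (k := (n - 6) / 3) (by omega) (by omega)
  have hx : 1 ≤ (n : ℝ) ^ (1 / 96 * Real.log n) :=
    Real.one_le_rpow (by exact_mod_cast (by omega : 1 ≤ n))
      (mul_nonneg (by norm_num) (Real.log_natCast_nonneg n))
  refine ⟨⟨_, hu⟩, ?_, ?_⟩
  · refine le_of_sq_le_sq (hb.trans ?_) (Nat.cast_nonneg _)
    exact_mod_cast h1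
  · refine ((le_self_pow₀ hx two_ne_zero).trans hb).trans ?_
    exact_mod_cast h2
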